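/- Let $C_k$ denote the cycle graph on $k$ vertices ($k \ge 3$), and let $G \,\square\, H$ denote the Cartesian product of graphs: its vertex set is $V(G) \times V(H)$, and $(u,v)$ and $(u',v')$ are adjacent if and only if either $u=u'$ and $vv' \in E(H)$, or $v=v'$ and $uu' \in E(G)$. A decomposition of a graph is a set of subgraphs whose edge sets partition the edge set of the graph. If $m \ge 3$ and $n$ is a positive multiple of $3$, then $C_m \,\square\, C_n$ has a decomposition into exactly three subgraphs, each of which is a cycle of length $2mn/3$. -/

import Mathlib

/-- A decomposition of `G`: a set of subgraphs of `G` whose edge sets partition the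
edge set of `G`. -/
def IsDecomposition {V : Type*} (G : SimpleGraph V) (D : Set G.Subgraph) : Prop :=
  D.PairwiseDisjoint (fun H => H.edgeSet) ∧ (⋃ H ∈ D, H.edgeSet) = G.edgeSet

/-- The subgraph `H` is a cycle of length `k`, that is, it is isomorphic to the cycle `C_k`
(a cycle has length at least three). -/
def IsCycleOfLength {V : Type*} {G : SimpleGraph V} (H : G.Subgraph) (k : ℕ) : Prop :=
  3 ≤ k ∧ Nonempty (H.coe ≃g SimpleGraph.cycleGraph k)

/-!
The edges of the torus are coloured with three colours so that at every vertex two of the colours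
occur, on two edges each, every colour class is connected, and all colours are used equally often.
Each colour class is then a connected two-regular graph, hence a cycle
(`nonempty_iso_cycleGraph`), and its length is a third of the number `2 * m * n` of all edges.

Such colourings are grown from small ones by two operations. Both replace the edges across a gap
between two neighbouring rows or columns by paths of the same colours, so that connected colour
classes stay connected.

* `IsCyclic.insertRows` inserts a block of rows, all of whose edges are covered by paths that join
  the two ends of each vertical edge across the gap.
* `IsCyclic.appendColumns` inserts two columns and replaces each horizontal edge across the gap by a
  path that moves up one row and back. This requires that consecutive edges across the gap have
  different colours; the gap used here has the colours `0, 1, 2, 0, 1, 2, …`, which persists.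

The parities of `m` and `n` decide which small colourings serve (`exists_isCyclic`). For `m` odd,
the monotone staircases on the `3 × 3` torus can be grown in both directions. For `m ≥ 6` even and
`n` odd, staircases on the `6 × 3` torus do the same. If `m` and `n` are even, staircases would not
close up to single cycles, and a colouring of the `4 × 6` torus with a block of six rows takes their
place. Finally, let `m = 4` and `n` odd. A closed walk that crosses the gap between two rows an odd
number of times has odd length, while the cycles have even length `2 * m * n / 3`; so every colour
crosses every such gap an even number of times, and as there are four edges across it, some colour
is absent. Here the three gaps of a colouring of the `4 × 3` torus miss the three different colours,
and a block of two rows in the two colours present is inserted equally often into each gap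
(`exists_four`). The small colourings are verified by computation, connectedness through a search
along the edges of one colour (`component`).
-/

/-! ### Connected two-regular graphs -/

/-- A finite connected graph in which every vertex has exactly two neighbours is a cycle graph. -/
theorem nonempty_iso_cycleGraph {W : Type*} [Fintype W] {G : SimpleGraph W}
    (hconn : G.Connected) (h2 : ∀ v, (G.neighborSet v).ncard = 2) :
    3 ≤ Fintype.card W ∧ Nonempty (G ≃g SimpleGraph.cycleGraph (Fintype.card W)) := by
  classical
  obtain ⟨v⟩ := hconn.nonempty
  have hcyc : G.IsCycles := fun v _ => h2 v
  have hne : (G.neighborSet v).Nonempty :=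
    Set.nonempty_of_ncard_ne_zero (by rw [h2 v]; norm_num)
  obtain ⟨p, hp, hverts⟩ :=
    hcyc.exists_cycle_toSubgraph_verts_eq_connectedComponentSupp
      (c := G.connectedComponentMk v) rfl hne
  have hmem : ∀ w, w ∈ p.support := fun w => by
    rw [← SimpleGraph.Walk.mem_verts_toSubgraph, hverts]
    exact SimpleGraph.ConnectedComponent.sound (hconn.preconnected w v)
  have hlen : p.length = Fintype.card W := by
    have htail : p.support.tail.toFinset = Finset.univ := by
      ext w
      simp only [List.mem_toFinset, Finset.mem_univ, iff_true]
      have := hmem w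
      rw [SimpleGraph.Walk.mem_support_iff] at this
      rcases this with rfl | h
      · exact SimpleGraph.Walk.end_mem_tail_support hp.not_nil
      · exact h
    rw [← Finset.card_univ, ← htail, List.toFinset_card_of_nodup hp.support_nodup]
    simp
  have h3 : 3 ≤ Fintype.card W := hlen ▸ hp.three_le_length
  refine ⟨h3, ?_⟩
  obtain ⟨f⟩ := (SimpleGraph.cycleGraph_isContained_iff (G := G) (n := Fintype.card W)
    (by omega)).2 ⟨v, p, hp, hlen⟩
  have hbij : Function.Bijective f :=
    (Fintype.bijective_iff_injective_and_card f).2 ⟨f.injective, by simp⟩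
  have hdeg : ∀ u, ((SimpleGraph.cycleGraph (Fintype.card W)).neighborSet u).ncard = 2 := by
    obtain ⟨k, hk⟩ := Nat.exists_eq_add_of_le' h3
    rw [hk]
    intro u
    rw [← SimpleGraph.coe_neighborFinset, Set.ncard_coe_finset]
    exact SimpleGraph.cycleGraph_degree_three_le
  refine ⟨(RelIso.mk (Equiv.ofBijective f hbij) ?_).symm⟩
  intro a b
  simp only [Equiv.ofBijective_apply]
  refine ⟨fun hab => ?_, fun hab => f.toHom.map_adj hab⟩
  have hsub : f '' (SimpleGraph.cycleGraph (Fintype.card W)).neighborSet a ⊆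
      G.neighborSet (f a) := by
    rintro _ ⟨x, hx, rfl⟩
    exact f.toHom.map_adj hx
  have heq := Set.eq_of_subset_of_ncard_le hsub
    (by rw [h2, Set.ncard_image_of_injective _ hbij.injective, hdeg])
  have : f b ∈ G.neighborSet (f a) := hab
  rw [← heq] at this
  obtain ⟨x, hx, hxb⟩ := this
  rwa [← f.injective hxb]

/-! ### Colourings of the edges of a torus -/

/-- The successor of `i` in the cyclic order on `{0, …, n - 1}`. -/
def cycSucc (n i : ℕ) : ℕ := if i + 1 = n then 0 else i + 1

/-- The predecessor of `i` in the cyclic order on `{0, …, n - 1}`. -/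
def cycPred (n i : ℕ) : ℕ := if i = 0 then n - 1 else i - 1

lemma cycSucc_lt {n i : ℕ} (h : i < n) : cycSucc n i < n := by
  unfold cycSucc; split <;> omega

lemma cycPred_lt {n i : ℕ} (h : i < n) : cycPred n i < n := by
  unfold cycPred; split <;> omega

lemma cycSucc_cycPred {n i : ℕ} (h : i < n) : cycSucc n (cycPred n i) = i := by
  rcases Nat.eq_zero_or_pos i with rfl | hi
  · simp [cycSucc, cycPred, Nat.sub_add_cancel h]
  · rw [cycPred, if_neg (by omega), cycSucc, if_neg (by omega), Nat.sub_add_cancel hi]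

lemma cycPred_cycSucc (n i : ℕ) : cycPred n (cycSucc n i) = i := by
  rcases eq_or_ne (i + 1) n with rfl | hi
  · simp [cycSucc, cycPred]
  · simp [cycSucc, cycPred, hi]

/-- A colouring with three colours of the edges of a torus grid. The colour `hor i j` belongs to the
edge from `(i, j)` to the next vertex `(i + 1, j)` of its row, and `ver i j` to the edge from `(i, j)`
to the next vertex `(i, j + 1)` of its column. The size of the torus is not part of the data: for an
`m × n` torus only the values at `i < m`, `j < n` matter, and `i + 1`, `j + 1` are read cyclically. -/
structure TorusColoring where
  hor : ℕ → ℕ → Fin 3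
  ver : ℕ → ℕ → Fin 3

/-- Among the colours of the left, right, lower and upper edge at a vertex there are exactly two
distinct ones, each occurring twice. -/
def PairedUp (l r d u : Fin 3) : Prop :=
  (l = r ∧ d = u ∧ l ≠ d) ∨ (l = d ∧ r = u ∧ l ≠ r) ∨ (l = u ∧ r = d ∧ l ≠ r)

instance (l r d u : Fin 3) : Decidable (PairedUp l r d u) := by
  unfold PairedUp; infer_instance

namespace TorusColoring

variable {m n h s r : ℕ} {K B : TorusColoring} {c : Fin 3} {p q : ℕ × ℕ}

/-- At every vertex of the `m × n` torus two of the three colours occur, on two edges each. -/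
def Local (K : TorusColoring) (m n : ℕ) : Prop :=
  ∀ i < m, ∀ j < n,
    PairedUp (K.hor (cycPred m i) j) (K.hor i j) (K.ver i (cycPred n j)) (K.ver i j)

/-- `K.Step m n h c p q`: the edge leading from `p` to the right or upwards to `q` has colour `c`.
Only vertical edges starting below height `h` are allowed, so that `h = n` describes the torus,
while `h = n - 1` describes the annulus obtained by cutting the torus above its last row. -/
inductive Step (K : TorusColoring) (m n h : ℕ) (c : Fin 3) : ℕ × ℕ → ℕ × ℕ → Prop
  | right {i j : ℕ} : i < m → j < n → K.hor i j = c → Step K m n h c (i, j) (cycSucc m i, j)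
  | up {i j : ℕ} : i < m → j < h → K.ver i j = c → Step K m n h c (i, j) (i, cycSucc n j)

/-- Two vertices are joined by a walk of colour `c`; see `Step` for the role of `h`. -/
abbrev Linked (K : TorusColoring) (m n h : ℕ) (c : Fin 3) : ℕ × ℕ → ℕ × ℕ → Prop :=
  Relation.EqvGen (K.Step m n h c)

lemma Step.linked (hs : K.Step m n h c p q) : K.Linked m n h c p q := .rel _ _ hs

lemma linked_map {m' n' h' : ℕ} {K' : TorusColoring} (f : ℕ × ℕ → ℕ × ℕ)
    (hf : ∀ p q, K.Step m n h c p q → K'.Linked m' n' h' c (f p) (f q))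
    (hpq : K.Linked m n h c p q) : K'.Linked m' n' h' c (f p) (f q) := by
  induction hpq with
  | rel x y hxy => exact hf x y hxy
  | refl x => exact .refl _
  | symm x y _ ih => exact ih.symm
  | trans x y z _ _ ih₁ ih₂ => exact ih₁.trans _ _ _ ih₂

/-- Each colour class of `K` on the `m × n` torus is two-regular and connected. Connectedness is
only required between the starting points of edges, which meet every edge. -/
structure IsCyclic (K : TorusColoring) (m n : ℕ) : Prop where
  loc : K.Local m n
  conn : ∀ c, ∀ i < m, ∀ j < n, ∀ i' < m, ∀ j' < n,
    K.hor i j = c ∨ K.ver i j = c → K.hor i' j' = c ∨ K.ver i' j' = c →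
      K.Linked m n n c (i, j) (i', j')

/-- An annulus of `s` rows that may be inserted into a gap between two rows of a torus whose vertical
edges have the colours `B.ver · (s - 1)`. For each of these edges, its colour class in the annulus
joins the bottom and the top vertex of the column of the edge, and each starting point of an edge of
the annulus is joined in that colour to the bottom vertex of a column whose edge has the colour. -/
structure IsBlock (B : TorusColoring) (m s : ℕ) : Prop where
  loc : B.Local m s
  link : ∀ i < m, B.Linked m s (s - 1) (B.ver i (s - 1)) (i, 0) (i, s - 1)
  cover : ∀ c, ∀ i < m, ∀ j < s, B.hor i j = c ∨ B.ver i j = c →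
    ∃ k < m, B.ver k (s - 1) = c ∧ B.Linked m s (s - 1) c (k, 0) (i, j)

/-! ### Deciding connectedness by a search -/

/-- The vertices joined to `p` by an edge of colour `c`; see `Step` for the role of `h`. -/
def neighbours (K : TorusColoring) (m n h : ℕ) (c : Fin 3) (p : ℕ × ℕ) : List (ℕ × ℕ) :=
  (if K.hor p.1 p.2 = c then [(cycSucc m p.1, p.2)] else []) ++
  (if K.hor (cycPred m p.1) p.2 = c then [(cycPred m p.1, p.2)] else []) ++
  (if p.2 < h ∧ K.ver p.1 p.2 = c then [(p.1, cycSucc n p.2)] else []) ++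
  (if cycPred n p.2 < h ∧ K.ver p.1 (cycPred n p.2) = c then [(p.1, cycPred n p.2)] else [])

/-- The vertices reached from `S` in at most `k` rounds, where `f` lists the neighbours. -/
def explore {α : Type*} [DecidableEq α] (f : α → List α) : ℕ → List α → List α
  | 0, S => S
  | k + 1, S => explore f k (S.flatMap f ∪ S)

lemma explore_induction {α : Type*} [DecidableEq α] {f : α → List α} {P : α → Prop}
    (hP : ∀ x, P x → ∀ y ∈ f x, P y) (k : ℕ) {S : List α} (hS : ∀ x ∈ S, P x) :
    ∀ x ∈ explore f k S, P x := by
  induction k generalizing S with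
  | zero => exact hS
  | succ k ih =>
    refine ih fun x hx => ?_
    rcases List.mem_union_iff.1 hx with hx | hx
    · obtain ⟨y, hy, hxy⟩ := List.mem_flatMap.1 hx
      exact hP y (hS y hy) x hxy
    · exact hS x hx

/-- The connected component of `p` in colour `c`. A path visits at most `m * n` vertices, so that
`m * n` rounds are enough. -/
def component (K : TorusColoring) (m n h : ℕ) (c : Fin 3) (p : ℕ × ℕ) : List (ℕ × ℕ) :=
  explore (K.neighbours m n h c) (m * n) [p]

lemma linked_of_mem_component (hm : p.1 < m) (hn : p.2 < n) 
    (hq : q ∈ K.component m n h c p) : K.Linked m n h c p q := by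
  suffices q.1 < m ∧ q.2 < n ∧ K.Linked m n h c p q from this.2.2
  refine explore_induction (P := fun q => q.1 < m ∧ q.2 < n ∧ K.Linked m n h c p q)
    ?_ (m * n) ?_ q hq
  · rintro ⟨i, j⟩ ⟨hi, hj, hl⟩ y hy
    simp only [neighbours, List.mem_append] at hy
    dsimp only at hi hj
    rcases hy with ((hy | hy) | hy) | hy <;> split_ifs at hy with hc <;>
      simp only [List.mem_singleton, List.not_mem_nil] at hy <;> subst hy
    · exact ⟨cycSucc_lt hi, hj, hl.trans _ _ _ (Step.right hi hj hc).linked⟩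
    · have := (Step.right (K := K) (h := h) (cycPred_lt hi) hj hc).linked
      rw [cycSucc_cycPred hi] at this
      exact ⟨cycPred_lt hi, hj, hl.trans _ _ _ this.symm⟩
    · exact ⟨hi, cycSucc_lt hj, hl.trans _ _ _ (Step.up hi hc.1 hc.2).linked⟩
    · have := (Step.up (K := K) (n := n) hi hc.1 hc.2).linked
      rw [cycSucc_cycPred hj] at this
      exact ⟨hi, cycPred_lt hj, hl.trans _ _ _ this.symm⟩
  · rintro x hx
    rw [List.mem_singleton] at hx
    subst hx
    exact ⟨hm, hn, .refl _⟩

/-- The starting points of the edges of colour `c`. -/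
def tails (K : TorusColoring) (m n : ℕ) (c : Fin 3) : List (ℕ × ℕ) :=
  (List.range m ×ˢ List.range n).filter fun p => K.hor p.1 p.2 = c ∨ K.ver p.1 p.2 = c

lemma mem_tails {i j : ℕ} :
    (i, j) ∈ K.tails m n c ↔ i < m ∧ j < n ∧ (K.hor i j = c ∨ K.ver i j = c) := by
  simp [tails, and_assoc]

lemma isCyclic_of_check (hloc : K.Local m n)
    (hconn : ∀ c, ∀ p ∈ (K.tails m n c).head?, K.tails m n c ⊆ K.component m n n c p) :
    K.IsCyclic m n := by
  refine ⟨hloc, fun c i hi j hj i' hi' j' hj' hc hc' => ?_⟩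
  have h₁ := mem_tails.2 ⟨hi, hj, hc⟩
  have h₂ := mem_tails.2 ⟨hi', hj', hc'⟩
  cases ht : K.tails m n c with
  | nil => simp [ht] at h₁
  | cons p l =>
    have hp : p ∈ K.tails m n c := by simp [ht]
    have hp' := mem_tails.1 hp
    have := hconn c p (by simp [ht])
    exact (linked_of_mem_component hp'.1 hp'.2.1 (this h₁)).symm.trans _ _ _
      (linked_of_mem_component hp'.1 hp'.2.1 (this h₂))

lemma isBlock_of_check (hs : 0 < s) (hloc : B.Local m s)
    (hlink : ∀ i < m, (i, s - 1) ∈ B.component m s (s - 1) (B.ver i (s - 1)) (i, 0))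
    (hcover : ∀ c, ∀ p ∈ B.tails m s c, ∃ k < m, B.ver k (s - 1) = c ∧
      p ∈ B.component m s (s - 1) c (k, 0)) :
    B.IsBlock m s := by
  refine ⟨hloc, fun i hi => linked_of_mem_component hi hs (hlink i hi),
    fun c i hi j hj hc => ?_⟩
  obtain ⟨k, hk, hkc, hmem⟩ := hcover c (i, j) (mem_tails.2 ⟨hi, hj, hc⟩)
  exact ⟨k, hk, hkc, linked_of_mem_component hk hs hmem⟩

/-! ### Inserting rows -/

/-- The colouring that arises by inserting the rows `0, …, s - 1` of `B` below row `r` of `K`. -/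
def insertRows (K B : TorusColoring) (r s : ℕ) : TorusColoring where
  hor i j := if j < r then K.hor i j else if j < r + s then B.hor i (j - r) else K.hor i (j - s)
  ver i j := if j < r then K.ver i j else if j < r + s then B.ver i (j - r) else K.ver i (j - s)

section insertRows

lemma insertRows_hor_of_lt {i j : ℕ} (hj : j < r) : (K.insertRows B r s).hor i j = K.hor i j := by
  simp [insertRows, hj]

lemma insertRows_ver_of_lt {i j : ℕ} (hj : j < r) : (K.insertRows B r s).ver i j = K.ver i j := by
  simp [insertRows, hj]

lemma insertRows_hor_add {i j : ℕ} (hj : j < s) :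
    (K.insertRows B r s).hor i (r + j) = B.hor i j := by
  simp [insertRows, hj]

lemma insertRows_ver_add {i j : ℕ} (hj : j < s) :
    (K.insertRows B r s).ver i (r + j) = B.ver i j := by
  simp [insertRows, hj]

lemma insertRows_hor_of_le {i j : ℕ} (hj : r ≤ j) :
    (K.insertRows B r s).hor i (j + s) = K.hor i j := by
  have h₁ : ¬ j + s < r := by omega
  have h₂ : ¬ j + s < r + s := by omega
  simp [insertRows, h₁, h₂]

lemma insertRows_ver_of_le {i j : ℕ} (hj : r ≤ j) :
    (K.insertRows B r s).ver i (j + s) = K.ver i j := by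
  have h₁ : ¬ j + s < r := by omega
  have h₂ : ¬ j + s < r + s := by omega
  simp [insertRows, h₁, h₂]

/-- The position of row `j` after the insertion of `s` rows below row `r`. -/
def shiftRow (r s j : ℕ) : ℕ := if j < r then j else j + s

lemma insertRows_hor_shiftRow (i j : ℕ) :
    (K.insertRows B r s).hor i (shiftRow r s j) = K.hor i j := by
  unfold shiftRow
  split_ifs with hj
  · exact insertRows_hor_of_lt hj
  · exact insertRows_hor_of_le (by omega)

lemma insertRows_ver_shiftRow (i j : ℕ) :
    (K.insertRows B r s).ver i (shiftRow r s j) = K.ver i j := by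
  unfold shiftRow
  split_ifs with hj
  · exact insertRows_ver_of_lt hj
  · exact insertRows_ver_of_le (by omega)

lemma shiftRow_lt {j : ℕ} (hj : j < n) : shiftRow r s j < n + s := by
  unfold shiftRow; split <;> omega

lemma exists_row {j : ℕ} (hj : j < n + s) (hrn : r ≤ n) :
    (∃ k < n, j = shiftRow r s k) ∨ ∃ k < s, j = r + k := by
  by_cases h₁ : j < r
  · exact .inl ⟨j, by omega, by simp [shiftRow, h₁]⟩
  · by_cases h₂ : j < r + s
    · exact .inr ⟨j - r, by omega, by omega⟩
    · refine .inl ⟨j - s, by omega, ?_⟩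
      unfold shiftRow
      rw [if_neg (by omega)]
      omega

variable (hs : 0 < s) (hr : 0 < r) (hrn : r ≤ n)
  (hP : ∀ i < m, K.ver i (r - 1) = B.ver i (s - 1))

include hrn in
/-- Walks inside the block survive its insertion. -/
lemma linked_insertRows_block (hpq : B.Linked m s (s - 1) c p q) :
    (K.insertRows B r s).Linked m (n + s) (n + s) c (p.1, r + p.2) (q.1, r + q.2) := by
  refine linked_map (fun p => (p.1, r + p.2)) (fun p q hpq => ?_) hpq
  cases hpq with
  | @right i j hi hj hc =>
    exact (Step.right hi (by omega) (by rw [insertRows_hor_add hj, hc])).linked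
  | @up i j hi hj hc =>
    have h₁ : cycSucc s j = j + 1 := by unfold cycSucc; rw [if_neg (by omega)]
    have h₂ : cycSucc (n + s) (r + j) = r + cycSucc s j := by
      rw [h₁]; unfold cycSucc; rw [if_neg (by omega)]; omega
    have := (Step.up (n := n + s) (h := n + s) hi (by omega : r + j < n + s)
      (by rw [insertRows_ver_add (K := K) (s := s) (by omega), hc])).linked
    rwa [h₂] at this

include hs hr hrn hP in
lemma insertRows_local (hK : K.Local m n) (hB : B.Local m s) :
    (K.insertRows B r s).Local m (n + s) := by
  intro i hi j hj
  rcases exists_row hj hrn with ⟨k, hk, rfl⟩ | ⟨k, hk, rfl⟩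
  · have hd : (K.insertRows B r s).ver i (cycPred (n + s) (shiftRow r s k)) =
        K.ver i (cycPred n k) := by
      by_cases hkr : cycPred n k + 1 = r
      · have : cycPred (n + s) (shiftRow r s k) = r + (s - 1) := by
          unfold cycPred shiftRow at *; split_ifs at * <;> omega
        rw [this, insertRows_ver_add (by omega), ← hP i hi]
        congr 1; omega
      · have : cycPred (n + s) (shiftRow r s k) = shiftRow r s (cycPred n k) := by
          unfold cycPred shiftRow at *; split_ifs at * <;> omega
        rw [this, insertRows_ver_shiftRow]
    rw [hd, insertRows_hor_shiftRow, insertRows_hor_shiftRow, insertRows_ver_shiftRow]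
    exact hK i hi k hk
  · have hd : (K.insertRows B r s).ver i (cycPred (n + s) (r + k)) =
        B.ver i (cycPred s k) := by
      by_cases hk0 : k = 0
      · have h₁ : cycPred (n + s) (r + k) = r - 1 := by
          unfold cycPred; split_ifs <;> omega
        have h₂ : cycPred s k = s - 1 := by simp [cycPred, hk0]
        rw [h₁, h₂, insertRows_ver_of_lt (by omega), hP i hi]
      · have : cycPred (n + s) (r + k) = r + cycPred s k := by
          unfold cycPred; split_ifs <;> omega
        rw [this, insertRows_ver_add (cycPred_lt hk)]
    rw [hd, insertRows_hor_add hk, insertRows_hor_add hk, insertRows_ver_add hk]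
    exact hB i hi k hk

include hs hr hrn hP in
/-- Walks of the old torus survive the insertion of a block: a vertical edge across the gap is
replaced by its lower half, a path through the block and its upper half. -/
lemma linked_insertRows (hB : B.IsBlock m s) (hpq : K.Linked m n n c p q) :
    (K.insertRows B r s).Linked m (n + s) (n + s) c
      (p.1, shiftRow r s p.2) (q.1, shiftRow r s q.2) := by
  refine linked_map (fun p => (p.1, shiftRow r s p.2)) (fun p q hpq => ?_) hpq
  cases hpq with
  | @right i j hi hj hc =>
    exact (Step.right hi (shiftRow_lt hj) (by rw [insertRows_hor_shiftRow, hc])).linked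
  | @up i j hi hj hc =>
    have h₀ := (Step.up (n := n + s) (h := n + s) hi (shiftRow_lt (r := r) (s := s) hj)
      (by rw [insertRows_ver_shiftRow (K := K) (B := B), hc])).linked
    by_cases hjr : j + 1 = r
    · have hjc : B.ver i (s - 1) = c := by
        rw [← hP i hi, ← hc]; congr 1; omega
      have h₁ : cycSucc (n + s) (shiftRow r s j) = r + 0 := by
        unfold cycSucc shiftRow; split_ifs <;> omega
      have h₂ := linked_insertRows_block (K := K) hrn (hB.link i hi)
      have h₃ : cycSucc (n + s) (r + (s - 1)) = shiftRow r s (cycSucc n j) := by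
        unfold cycSucc shiftRow; split_ifs <;> omega
      have h₄ := (Step.up (n := n + s) (h := n + s) hi (by omega : r + (s - 1) < n + s)
        (by rw [insertRows_ver_add (K := K) (s := s) (by omega), hjc])).linked
      rw [h₁] at h₀
      rw [h₃] at h₄
      rw [hjc] at h₂
      exact (h₀.trans _ _ _ h₂).trans _ _ _ h₄
    · have h₁ : cycSucc (n + s) (shiftRow r s j) = shiftRow r s (cycSucc n j) := by
        unfold cycSucc shiftRow; split_ifs <;> omega
      rwa [h₁] at h₀

include hs hr hrn hP in
theorem IsCyclic.insertRows (hK : K.IsCyclic m n) (hB : B.IsBlock m s) :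
    (K.insertRows B r s).IsCyclic m (n + s) := by
  refine ⟨insertRows_local hs hr hrn hP hK.loc hB.loc, fun c => ?_⟩
  -- Each starting point of an edge is linked to the image of one in the old torus.
  have key : ∀ i < m, ∀ j < n + s,
      ((K.insertRows B r s).hor i j = c ∨ (K.insertRows B r s).ver i j = c) →
      ∃ i' < m, ∃ j' < n, (K.hor i' j' = c ∨ K.ver i' j' = c) ∧
        (K.insertRows B r s).Linked m (n + s) (n + s) c (i', shiftRow r s j') (i, j) := by
    intro i hi j hj hc
    rcases exists_row hj hrn with ⟨k, hk, rfl⟩ | ⟨k, hk, rfl⟩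
    · rw [insertRows_hor_shiftRow, insertRows_ver_shiftRow] at hc
      exact ⟨i, hi, k, hk, hc, .refl _⟩
    · rw [insertRows_hor_add hk, insertRows_ver_add hk] at hc
      obtain ⟨i', hi', hc', hl⟩ := hB.cover c i hi k hk hc
      have hv : K.ver i' (r - 1) = c := by rw [hP i' hi', hc']
      refine ⟨i', hi', r - 1, by omega, .inr hv, ?_⟩
      have h₀ : shiftRow r s (r - 1) = r - 1 := by unfold shiftRow; rw [if_pos (by omega)]
      have h₁ : cycSucc (n + s) (r - 1) = r + 0 := by
        unfold cycSucc; rw [if_neg (by omega)]; omega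
      have h₂ := (Step.up (n := n + s) (h := n + s) hi' (by omega : r - 1 < n + s)
        (by rw [insertRows_ver_of_lt (K := K) (B := B) (s := s) (by omega : r - 1 < r), hv])).linked
      rw [h₁] at h₂
      rw [h₀]
      exact h₂.trans _ _ _ (linked_insertRows_block (K := K) hrn hl)
  intro i hi j hj i' hi' j' hj' hc hc'
  obtain ⟨a, ha, b, hb, hab, hl⟩ := key i hi j hj hc
  obtain ⟨a', ha', b', hb', hab', hl'⟩ := key i' hi' j' hj' hc'
  exact (hl.symm.trans _ _ _ (linked_insertRows hs hr hrn hP hB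
    (hK.conn c a ha b hb a' ha' b' hb' hab hab'))).trans _ _ _ hl'

end insertRows

/-! ### Appending two columns -/

/-- Two columns appended to an `m × n` torus. An edge of colour `c` from the last column back to
column `0` in row `j` becomes a detour: right to column `m`, up to row `j + 1`, right to column
`m + 1`, down to row `j`, and on to column `0`. These detours use all new edges. -/
def appendColumns (K : TorusColoring) (m n : ℕ) : TorusColoring where
  hor i j := if i < m then K.hor i j else
    if i = m then K.hor (m - 1) (cycPred n j) else K.hor (m - 1) j
  ver i j := if i < m then K.ver i j else K.hor (m - 1) j

section appendColumns

lemma appendColumns_hor_of_lt {i j : ℕ} (hi : i < m) :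
    (K.appendColumns m n).hor i j = K.hor i j := by simp [appendColumns, hi]

lemma appendColumns_ver_of_lt {i j : ℕ} (hi : i < m) :
    (K.appendColumns m n).ver i j = K.ver i j := by simp [appendColumns, hi]

lemma appendColumns_hor_self {j : ℕ} :
    (K.appendColumns m n).hor m j = K.hor (m - 1) (cycPred n j) := by simp [appendColumns]

lemma appendColumns_hor_succ {j : ℕ} :
    (K.appendColumns m n).hor (m + 1) j = K.hor (m - 1) j := by simp [appendColumns]

lemma appendColumns_ver_self {j : ℕ} :
    (K.appendColumns m n).ver m j = K.hor (m - 1) j := by simp [appendColumns]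

lemma appendColumns_ver_succ {j : ℕ} :
    (K.appendColumns m n).ver (m + 1) j = K.hor (m - 1) j := by simp [appendColumns]

/-- The edges of the detour that replaces the edge from column `m - 1` to column `0` in row `j`. -/
lemma linked_zigzag (hm : 0 < m) {j : ℕ} (hj : j < n) :
    let L := (K.appendColumns m n).Linked (m + 2) n n (K.hor (m - 1) j)
    L (m - 1, j) (m, j) ∧ L (m, j) (m, cycSucc n j) ∧
      L (m, cycSucc n j) (m + 1, cycSucc n j) ∧ L (m + 1, cycSucc n j) (m + 1, j) ∧
      L (m + 1, j) (0, j) := by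
  have e₁ : cycSucc (m + 2) (m - 1) = m := by unfold cycSucc; split_ifs <;> omega
  have e₂ : cycSucc (m + 2) m = m + 1 := by unfold cycSucc; split_ifs <;> omega
  have e₃ : cycSucc (m + 2) (m + 1) = 0 := by unfold cycSucc; split_ifs <;> omega
  refine ⟨?_, ?_, ?_, ?_, ?_⟩
  · have := (Step.right (m := m + 2) (h := n) (by omega : m - 1 < m + 2) hj
      (appendColumns_hor_of_lt (K := K) (m := m) (n := n) (by omega))).linked
    rwa [e₁] at this
  · exact (Step.up (by omega) hj appendColumns_ver_self).linked
  · have := (Step.right (m := m + 2) (h := n) (by omega : m < m + 2) (cycSucc_lt hj)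
      (appendColumns_hor_self (K := K) (n := n))).linked
    rwa [e₂, cycPred_cycSucc] at this
  · exact (Step.up (by omega) hj appendColumns_ver_succ).linked.symm
  · have := (Step.right (m := m + 2) (h := n) (by omega : m + 1 < m + 2) hj
      (appendColumns_hor_succ (K := K) (m := m) (n := n))).linked
    rwa [e₃] at this

lemma linked_appendColumns (hm : 0 < m) (hpq : K.Linked m n n c p q) :
    (K.appendColumns m n).Linked (m + 2) n n c p q := by
  refine linked_map id (fun p q hpq => ?_) hpq
  cases hpq with
  | @right i j hi hj hc =>
    by_cases him : i + 1 = m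
    · obtain ⟨h₁, h₂, h₃, h₄, h₅⟩ := linked_zigzag (K := K) hm hj
      have hi' : m - 1 = i := by omega
      have : cycSucc m i = 0 := by simp [cycSucc, him]
      rw [hi', hc] at h₁ h₂ h₃ h₄ h₅
      simp only [id, this]
      exact (((h₁.trans _ _ _ h₂).trans _ _ _ h₃).trans _ _ _ h₄).trans _ _ _ h₅
    · have h₁ : cycSucc m i = cycSucc (m + 2) i := by
        unfold cycSucc; split_ifs <;> omega
      rw [h₁]
      exact (Step.right (by omega) hj (by rw [appendColumns_hor_of_lt hi, hc])).linked
  | @up i j hi hj hc =>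
    exact (Step.up (by omega) hj (by rw [appendColumns_ver_of_lt hi, hc])).linked

/-- Two columns can be appended whenever consecutive edges from the last column to column `0` differ
in colour: then the two detours that meet at a new vertex have different colours. -/
theorem IsCyclic.appendColumns (hm : 0 < m) (hK : K.IsCyclic m n)
    (hne : ∀ j < n, K.hor (m - 1) (cycPred n j) ≠ K.hor (m - 1) j) :
    (K.appendColumns m n).IsCyclic (m + 2) n := by
  refine ⟨fun i hi j hj => ?_, fun c => ?_⟩
  · rcases lt_or_ge i m with him | him
    · have h₁ : (K.appendColumns m n).hor (cycPred (m + 2) i) j = K.hor (cycPred m i) j := by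
        by_cases hi0 : i = 0
        · simp [cycPred, hi0, appendColumns_hor_succ]
        · have : cycPred (m + 2) i = cycPred m i := by simp [cycPred, hi0]
          rw [this, appendColumns_hor_of_lt (cycPred_lt him)]
      rw [h₁, appendColumns_hor_of_lt him, appendColumns_ver_of_lt him,
        appendColumns_ver_of_lt him]
      exact hK.loc i him j hj
    · rcases (by omega : i = m ∨ i = m + 1) with rfl | rfl
      · have : cycPred (i + 2) i = i - 1 := by unfold cycPred; split_ifs <;> omega
        rw [this, appendColumns_hor_of_lt (by omega), appendColumns_hor_self,
          appendColumns_ver_self, appendColumns_ver_self]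
        exact .inr (.inr ⟨rfl, rfl, (hne j hj).symm⟩)
      · have : cycPred (m + 2) (m + 1) = m := by simp [cycPred]
        rw [this, appendColumns_hor_self, appendColumns_hor_succ,
          appendColumns_ver_succ, appendColumns_ver_succ]
        exact .inr (.inl ⟨rfl, rfl, hne j hj⟩)
  · have key : ∀ i < m + 2, ∀ j < n,
        ((K.appendColumns m n).hor i j = c ∨ (K.appendColumns m n).ver i j = c) →
        ∃ i' < m, ∃ j' < n, (K.hor i' j' = c ∨ K.ver i' j' = c) ∧
          (K.appendColumns m n).Linked (m + 2) n n c (i', j') (i, j) := by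
      intro i hi j hj hc
      rcases lt_or_ge i m with him | him
      · rw [appendColumns_hor_of_lt him, appendColumns_ver_of_lt him] at hc
        exact ⟨i, him, j, hj, hc, .refl _⟩
      · rcases (by omega : i = m ∨ i = m + 1) with rfl | rfl
        · rw [appendColumns_hor_self, appendColumns_ver_self] at hc
          rcases hc with hc | hc
          · obtain ⟨h₁, h₂, -⟩ := linked_zigzag (K := K) hm (cycPred_lt hj)
            rw [hc, cycSucc_cycPred hj] at h₂
            rw [hc] at h₁
            exact ⟨i - 1, by omega, _, cycPred_lt hj, .inl hc, h₁.trans _ _ _ h₂⟩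
          · obtain ⟨h₁, -⟩ := linked_zigzag (K := K) hm hj
            rw [hc] at h₁
            exact ⟨i - 1, by omega, j, hj, .inl hc, h₁⟩
        · rw [appendColumns_hor_succ, appendColumns_ver_succ, or_self] at hc
          obtain ⟨h₁, h₂, h₃, h₄, -⟩ := linked_zigzag (K := K) hm hj
          rw [hc] at h₁ h₂ h₃ h₄
          exact ⟨m - 1, by omega, j, hj, .inl hc,
            ((h₁.trans _ _ _ h₂).trans _ _ _ h₃).trans _ _ _ h₄⟩
    intro i hi j hj i' hi' j' hj' hc hc'
    obtain ⟨a, ha, b, hb, hab, hl⟩ := key i hi j hj hc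
    obtain ⟨a', ha', b', hb', hab', hl'⟩ := key i' hi' j' hj' hc'
    exact (hl.symm.trans _ _ _ (linked_appendColumns hm
      (hK.conn c a ha b hb a' ha' b' hb' hab hab'))).trans _ _ _ hl'

end appendColumns

end TorusColoring

/-! ### Counting edges -/

open Finset

namespace TorusColoring

variable {m n s r : ℕ} {K B : TorusColoring} {c : Fin 3}

/-- The number of edges of colour `c` on the `m × n` torus. -/
def edgeCount (K : TorusColoring) (m n : ℕ) (c : Fin 3) : ℕ :=
  ∑ j ∈ range n, ∑ i ∈ range m,
    ((if K.hor i j = c then 1 else 0) + if K.ver i j = c then 1 else 0)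

lemma sum_range_insert (f g F : ℕ → ℕ) (hrn : r ≤ n) (h₁ : ∀ j < r, F j = f j)
    (h₂ : ∀ j < s, F (r + j) = g j) (h₃ : ∀ j, r ≤ j → F (j + s) = f j) :
    ∑ j ∈ range (n + s), F j = ∑ j ∈ range n, f j + ∑ j ∈ range s, g j := by
  obtain ⟨t, rfl⟩ := Nat.exists_eq_add_of_le hrn
  rw [show r + t + s = r + s + t by omega, sum_range_add, sum_range_add, sum_range_add,
    sum_congr rfl fun j hj => h₁ j (mem_range.1 hj), 
    sum_congr rfl fun j hj => h₂ j (mem_range.1 hj),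
    sum_congr rfl fun j _ => (by rw [show r + s + j = r + j + s by omega, h₃ _ (by omega)] :
      F (r + s + j) = f (r + j))]
  exact Nat.add_right_comm _ _ _

lemma edgeCount_insertRows (hrn : r ≤ n) :
    (K.insertRows B r s).edgeCount m (n + s) c = K.edgeCount m n c + B.edgeCount m s c := by
  refine sum_range_insert _ _ _ hrn (fun j hj => ?_) (fun j hj => ?_) (fun j hj => ?_)
  · simp only [insertRows_hor_of_lt hj, insertRows_ver_of_lt hj]
  · simp only [insertRows_hor_add hj, insertRows_ver_add hj]
  · simp only [insertRows_hor_of_le hj, insertRows_ver_of_le hj]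

lemma sum_range_cycPred (f : ℕ → ℕ) :
    ∑ j ∈ range n, f (cycPred n j) = ∑ j ∈ range n, f j := by
  cases n with
  | zero => rfl
  | succ k => rw [sum_range_succ', sum_range_succ]; simp [cycPred]

lemma edgeCount_appendColumns :
    (K.appendColumns m n).edgeCount (m + 2) n c =
      K.edgeCount m n c + 4 * ∑ j ∈ range n, if K.hor (m - 1) j = c then 1 else 0 := by
  unfold edgeCount
  simp only [sum_range_succ _ (m + 1), sum_range_succ _ m, appendColumns_hor_self,
    appendColumns_hor_succ, appendColumns_ver_self, appendColumns_ver_succ, sum_add_distrib]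
  rw [sum_range_cycPred fun j => if K.hor (m - 1) j = c then 1 else 0]
  have h₁ : ∀ j, ∀ i ∈ range m, (if (K.appendColumns m n).hor i j = c then 1 else 0) =
      if K.hor i j = c then 1 else 0 := fun j i hi => by
    rw [appendColumns_hor_of_lt (mem_range.1 hi)]
  have h₂ : ∀ j, ∀ i ∈ range m, (if (K.appendColumns m n).ver i j = c then 1 else 0) =
      if K.ver i j = c then 1 else 0 := fun j i hi => by
    rw [appendColumns_ver_of_lt (mem_range.1 hi)]
  simp only [sum_congr rfl (h₁ _), sum_congr rfl (h₂ _)]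
  ring

/-! ### Growing a torus -/

/-- A block can be inserted `k` times at the same place, because its last row of vertical edges has
the same colours as the gap it is inserted into. -/
theorem IsCyclic.exists_insertRows (hK : K.IsCyclic m n) (hB : B.IsBlock m s) (hs : 0 < s)
    (hr : 0 < r) (hrn : r ≤ n) (hP : ∀ i < m, K.ver i (r - 1) = B.ver i (s - 1)) (k : ℕ) :
    ∃ K' : TorusColoring, K'.IsCyclic m (n + s * k) ∧
      (∀ c, K'.edgeCount m (n + s * k) c = K.edgeCount m n c + k * B.edgeCount m s c) ∧
      (∀ i, ∀ j < r, K'.hor i j = K.hor i j ∧ K'.ver i j = K.ver i j) ∧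
      ∀ i, ∀ j < s * k, K'.hor i (r + j) = B.hor i (j % s) := by
  induction k with
  | zero => exact ⟨K, by simpa using hK, by simp, by simp, by simp⟩
  | succ k ih =>
    obtain ⟨L, hL, hcount, hlow, hrep⟩ := ih
    refine ⟨L.insertRows B r s, ?_, fun c => ?_, fun i j hj => ?_, fun i j hj => ?_⟩
    · rw [Nat.mul_succ, ← add_assoc]
      exact hL.insertRows hs hr (by omega)
        (fun i hi => by rw [(hlow i (r - 1) (by omega)).2, hP i hi]) hB
    · rw [Nat.mul_succ, ← add_assoc, edgeCount_insertRows (by omega), hcount]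
      ring
    · rw [insertRows_hor_of_lt hj, insertRows_ver_of_lt hj]
      exact hlow i j hj
    · rcases lt_or_ge j s with hjs | hjs
      · rw [insertRows_hor_add hjs, Nat.mod_eq_of_lt hjs]
      · obtain ⟨t, rfl⟩ := Nat.exists_eq_add_of_le' hjs
        rw [← add_assoc, insertRows_hor_of_le (by omega), hrep i t (by lia),
          Nat.add_mod_right]

/-- The three colour classes are cycles of the same length, and the edges from the last column to
column `0` have the colours `0, 1, 2, 0, 1, 2, …`, so that columns can be appended. -/
structure IsExtendable (K : TorusColoring) (m n : ℕ) : Prop where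
  cyclic : K.IsCyclic m n
  count : ∀ c, 3 * K.edgeCount m n c = 2 * m * n
  last : ∀ j < n, K.hor (m - 1) j = Fin.ofNat 3 j

lemma three_mul_sum_range_cast (hn : 3 ∣ n) (c : Fin 3) :
    3 * ∑ j ∈ range n, (if Fin.ofNat 3 j = c then 1 else 0) = n := by
  obtain ⟨q, rfl⟩ := hn
  induction q with
  | zero => simp
  | succ q ih =>
    rw [Nat.mul_succ, sum_range_add, mul_add, ih]
    have h : ∀ j, Fin.ofNat 3 (3 * q + j) = Fin.ofNat 3 j := fun j => by
      rw [Fin.ext_iff, Fin.val_ofNat, Fin.val_ofNat, Nat.mul_add_mod]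
    simp only [h]
    congr 1
    clear ih
    revert c
    decide

lemma IsExtendable.appendColumns (hm : 0 < m) (hn : 3 ∣ n) (hK : K.IsExtendable m n) :
    (K.appendColumns m n).IsExtendable (m + 2) n := by
  refine ⟨hK.cyclic.appendColumns hm fun j hj => ?_, fun c => ?_, fun j hj => ?_⟩
  · rw [hK.last j hj, hK.last _ (cycPred_lt hj), Ne, Fin.ext_iff, Fin.val_ofNat,
      Fin.val_ofNat]
    unfold cycPred
    split_ifs <;> omega
  · rw [edgeCount_appendColumns, mul_add, hK.count, sum_congr rfl fun j hj => by
      rw [hK.last j (mem_range.1 hj)]]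
    have := three_mul_sum_range_cast hn c
    linarith
  · rw [show m + 2 - 1 = m + 1 by omega, appendColumns_hor_succ, hK.last j hj]

lemma IsExtendable.exists_columns (hm : 0 < m) (hn : 3 ∣ n) (hK : K.IsExtendable m n) (k : ℕ) :
    ∃ K' : TorusColoring, K'.IsExtendable (m + 2 * k) n := by
  induction k with
  | zero => exact ⟨K, hK⟩
  | succ k ih =>
    obtain ⟨L, hL⟩ := ih
    exact ⟨L.appendColumns (m + 2 * k) n, hL.appendColumns (m := m + 2 * k) (by omega) hn⟩

lemma IsExtendable.exists_rows (hK : K.IsExtendable m n) (hB : B.IsBlock m s) (hs : 0 < s)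
    (hn : 0 < n) (hn3 : 3 ∣ n) (hs3 : 3 ∣ s)
    (hcount : ∀ c, 3 * B.edgeCount m s c = 2 * m * s)
    (hlast : ∀ j < s, B.hor (m - 1) j = Fin.ofNat 3 j)
    (hP : ∀ i < m, K.ver i (n - 1) = B.ver i (s - 1)) (k : ℕ) :
    ∃ K' : TorusColoring, K'.IsExtendable m (n + s * k) := by
  obtain ⟨L, hL, hLc, hlow, hrep⟩ := hK.cyclic.exists_insertRows hB hs hn le_rfl hP k
  refine ⟨L, hL, fun c => ?_, fun j hj => ?_⟩
  · rw [hLc, mul_add, hK.count, mul_left_comm, hcount]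
    ring
  · rcases lt_or_ge j n with hjn | hjn
    · rw [(hlow _ j hjn).1, hK.last j hjn]
    · obtain ⟨t, rfl⟩ := Nat.exists_eq_add_of_le hjn
      rw [hrep _ t (by omega), hlast _ (Nat.mod_lt _ hs), Fin.ext_iff, Fin.val_ofNat,
        Fin.val_ofNat, Nat.mod_mod_of_dvd _ hs3]
      omega

/-! ### Small colourings -/

/-- The colour of an edge is determined by the diagonal on which it starts. Each colour class is a
monotone staircase, which alternates between steps to the right and steps down. -/
def diagonal : TorusColoring where
  hor i j := Fin.ofNat 3 (i + j + 1)
  ver i j := Fin.ofNat 3 (i + j + 1)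

/-- The colouring given by the lists of the rows of `hor` and of `ver`. -/
def ofRows (H V : List (List (Fin 3))) : TorusColoring where
  hor i j := (H.getD j []).getD i 0
  ver i j := (V.getD j []).getD i 0

/-- Three cycles on the `4 × 6` torus. -/
def evenBase : TorusColoring := ofRows
  [[1,0,0,0], [2,2,0,1], [1,0,2,2], [0,1,2,0], [0,2,2,1], [2,1,2,2]]
  [[1,0,2,1], [2,0,0,0], [1,1,2,0], [1,0,1,2], [0,2,1,1], [0,1,2,1]]

/-- A block of six rows that fits above the last row of `evenBase`. -/
def evenBlock : TorusColoring := ofRows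
  [[2,2,0,0], [2,1,0,1], [2,0,0,2], [0,1,0,0], [2,2,2,1], [0,0,2,2]]
  [[2,1,0,1], [1,2,1,0], [1,0,1,2], [1,1,0,2], [2,1,0,1], [0,1,2,1]]

/-- Three cycles on the `4 × 3` torus. The colours of the vertical edges in the three gaps between
rows are those of the sets `{0, 1}`, `{1, 2}` and `{0, 2}`. -/
def fourBase : TorusColoring := ofRows
  [[1,1,2,0], [0,2,2,0], [0,2,1,1]]
  [[1,0,1,0], [1,2,1,2], [0,0,2,2]]

/-- A block of two rows in the colours `0` and `1` for the first gap of `fourBase`. -/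
def fourBlock01 : TorusColoring := ofRows [[1,0,1,0], [1,0,1,0]] [[0,1,0,1], [1,0,1,0]]

/-- A block of two rows in the colours `1` and `2` for the second gap of `fourBase`. -/
def fourBlock12 : TorusColoring := ofRows [[2,1,2,1], [2,1,2,1]] [[2,1,2,1], [1,2,1,2]]

/-- A block of two rows in the colours `0` and `2` for the third gap of `fourBase`. -/
def fourBlock02 : TorusColoring := ofRows [[2,2,0,0], [2,2,0,0]] [[2,0,0,2], [0,0,2,2]]

instance : Decidable (K.Local m n) := by unfold Local; infer_instance

lemma diagonal_three : diagonal.IsExtendable 3 3 :=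
  ⟨isCyclic_of_check (by decide +kernel) (by decide +kernel), by decide +kernel, by decide +kernel⟩

lemma diagonal_six : diagonal.IsExtendable 6 3 :=
  ⟨isCyclic_of_check (by decide +kernel) (by decide +kernel), by decide +kernel, by decide +kernel⟩

lemma diagonal_block_three : diagonal.IsBlock 3 3 :=
  isBlock_of_check (by norm_num) (by decide +kernel) (by decide +kernel) (by decide +kernel)

lemma diagonal_block_six : diagonal.IsBlock 6 6 :=
  isBlock_of_check (by norm_num) (by decide +kernel) (by decide +kernel) (by decide +kernel)

lemma evenBase_isExtendable : evenBase.IsExtendable 4 6 :=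
  ⟨isCyclic_of_check (by decide +kernel) (by decide +kernel), by decide +kernel, by decide +kernel⟩

lemma evenBlock_isBlock : evenBlock.IsBlock 4 6 :=
  isBlock_of_check (by norm_num) (by decide +kernel) (by decide +kernel) (by decide +kernel)

lemma fourBase_isCyclic : fourBase.IsCyclic 4 3 :=
  isCyclic_of_check (by decide +kernel) (by decide +kernel)

lemma fourBlock01_isBlock : fourBlock01.IsBlock 4 2 :=
  isBlock_of_check (by norm_num) (by decide +kernel) (by decide +kernel) (by decide +kernel)

lemma fourBlock12_isBlock : fourBlock12.IsBlock 4 2 :=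
  isBlock_of_check (by norm_num) (by decide +kernel) (by decide +kernel) (by decide +kernel)

lemma fourBlock02_isBlock : fourBlock02.IsBlock 4 2 :=
  isBlock_of_check (by norm_num) (by decide +kernel) (by decide +kernel) (by decide +kernel)

/-- Inserting as many blocks into each of the three gaps of `fourBase` keeps the cycles equally
long. -/
lemma exists_four (k : ℕ) : ∃ K : TorusColoring, K.IsCyclic 4 (3 + 6 * k) ∧
    ∀ c, 3 * K.edgeCount 4 (3 + 6 * k) c = 2 * 4 * (3 + 6 * k) := by
  -- The upper gaps are filled first: an insertion leaves the rows below it unchanged.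
  obtain ⟨K₃, h₃, c₃, l₃, -⟩ := fourBase_isCyclic.exists_insertRows fourBlock02_isBlock
    (r := 3) (by norm_num) (by norm_num) (by norm_num) (by decide +kernel) k
  obtain ⟨K₂, h₂, c₂, l₂, -⟩ := h₃.exists_insertRows fourBlock12_isBlock
    (r := 2) (by norm_num) (by norm_num) (by omega)
    (fun i hi => by rw [(l₃ i _ (by norm_num)).2]; revert i; decide +kernel) k
  obtain ⟨K₁, h₁, c₁, -, -⟩ := h₂.exists_insertRows fourBlock01_isBlock
    (r := 1) (by norm_num) (by norm_num) (by omega)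
    (fun i hi => by
      rw [(l₂ i _ (by norm_num)).2, (l₃ i _ (by norm_num)).2]; revert i; decide +kernel) k
  have e : 3 + 2 * k + 2 * k + 2 * k = 3 + 6 * k := by ring
  rw [e] at h₁ c₁
  refine ⟨K₁, h₁, fun c => ?_⟩
  rw [c₁, c₂, c₃]
  have key : ∀ c, fourBase.edgeCount 4 3 c = 8 ∧ fourBlock01.edgeCount 4 2 c +
      fourBlock12.edgeCount 4 2 c + fourBlock02.edgeCount 4 2 c = 16 := by decide +kernel
  obtain ⟨k₁, k₂⟩ := key c
  linear_combination 3 * k₁ + 3 * k * k₂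

theorem exists_isCyclic (hm : 3 ≤ m) (hn : 0 < n) (hn3 : 3 ∣ n) :
    ∃ K : TorusColoring, K.IsCyclic m n ∧ ∀ c, 3 * K.edgeCount m n c = 2 * m * n := by
  suffices h : (m = 4 ∧ n % 2 = 1) ∨ ∃ K : TorusColoring, K.IsExtendable m n by
    rcases h with ⟨rfl, h⟩ | ⟨K, hK⟩
    · obtain ⟨k, rfl⟩ : ∃ k, n = 3 + 6 * k := ⟨n / 6, by omega⟩
      exact exists_four k
    · exact ⟨K, hK.cyclic, hK.count⟩
  by_cases hmo : m % 2 = 1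
  · obtain ⟨k, rfl⟩ : ∃ k, n = 3 + 3 * k := ⟨n / 3 - 1, by omega⟩
    obtain ⟨l, rfl⟩ : ∃ l, m = 3 + 2 * l := ⟨m / 2 - 1, by omega⟩
    obtain ⟨K, hK⟩ := diagonal_three.exists_rows diagonal_block_three (by norm_num)
      (by norm_num) (by norm_num) (by norm_num) (by decide +kernel) (by decide +kernel)
      (by decide +kernel) k
    exact .inr (hK.exists_columns (by norm_num) hn3 l)
  by_cases hno : n % 2 = 1
  · by_cases h4 : m = 4
    · exact .inl ⟨h4, hno⟩
    obtain ⟨k, rfl⟩ : ∃ k, n = 3 + 6 * k := ⟨n / 6, by omega⟩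
    obtain ⟨l, rfl⟩ : ∃ l, m = 6 + 2 * l := ⟨m / 2 - 3, by omega⟩
    obtain ⟨K, hK⟩ := diagonal_six.exists_rows diagonal_block_six (by norm_num)
      (by norm_num) (by norm_num) (by norm_num) (by decide +kernel) (by decide +kernel)
      (by decide +kernel) k
    exact .inr (hK.exists_columns (by norm_num) hn3 l)
  · obtain ⟨k, rfl⟩ : ∃ k, n = 6 + 6 * k := ⟨n / 6 - 1, by omega⟩
    obtain ⟨l, rfl⟩ : ∃ l, m = 4 + 2 * l := ⟨m / 2 - 2, by omega⟩
    obtain ⟨K, hK⟩ := evenBase_isExtendable.exists_rows evenBlock_isBlock (by norm_num)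
      (by norm_num) (by norm_num) (by norm_num) (by decide +kernel) (by decide +kernel)
      (by decide +kernel) k
    exact .inr (hK.exists_columns (by norm_num) hn3 l)

end TorusColoring

/-! ### From colourings to decompositions -/

open SimpleGraph

variable {m n : ℕ}

/-- The cyclic successor as a map of `Fin n`. -/
def finNext (i : Fin n) : Fin n := ⟨cycSucc n i, cycSucc_lt i.2⟩

/-- The cyclic predecessor as a map of `Fin n`. -/
def finPrev (i : Fin n) : Fin n := ⟨cycPred n i, cycPred_lt i.2⟩

lemma finNext_finPrev (i : Fin n) : finNext (finPrev i) = i :=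
  Fin.ext (cycSucc_cycPred i.2)

lemma finPrev_finNext (i : Fin n) : finPrev (finNext i) = i :=
  Fin.ext (cycPred_cycSucc n i)

lemma eq_finNext_iff {i j : Fin n} : i = finNext j ↔ j = finPrev i :=
  ⟨fun h => h ▸ (finPrev_finNext j).symm, fun h => h ▸ (finNext_finPrev i).symm⟩

lemma finNext_ne (hn : 3 ≤ n) (i : Fin n) : finNext i ≠ i := by
  rw [Ne, Fin.ext_iff]
  simp only [finNext, cycSucc]
  split_ifs <;> omega

lemma finPrev_ne (hn : 3 ≤ n) (i : Fin n) : finPrev i ≠ i := by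
  rw [Ne, Fin.ext_iff]
  simp only [finPrev, cycPred]
  split_ifs <;> omega

lemma finNext_ne_finPrev (hn : 3 ≤ n) (i : Fin n) : finNext i ≠ finPrev i := by
  rw [Ne, Fin.ext_iff]
  simp only [finPrev, cycPred, finNext, cycSucc]
  split_ifs <;> omega

lemma cycleGraph_adj_iff (hn : 3 ≤ n) {u v : Fin n} :
    (cycleGraph n).Adj u v ↔ v = finNext u ∨ u = finNext v := by
  have key : ∀ u v : Fin n, (u - v).val = 1 ↔ u = finNext v := fun u v => by
    rw [Fin.ext_iff]
    simp only [finNext, cycSucc]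
    rcases le_or_gt v u with h | h
    · have h' : v.val ≤ u.val := h
      rw [Fin.coe_sub_iff_le.2 h]
      split_ifs <;> omega
    · have h' : u.val < v.val := h
      rw [Fin.coe_sub_iff_lt.2 h]
      split_ifs <;> omega
  rw [cycleGraph_adj', key, key, or_comm]

namespace TorusColoring

variable {K : TorusColoring} {c c' : Fin 3} {p q : Fin m × Fin n}

/-- The left, right, lower and upper neighbour of `p`. -/
def nbr (p : Fin m × Fin n) : Fin 4 → Fin m × Fin n :=
  ![(finPrev p.1, p.2), (finNext p.1, p.2), (p.1, finPrev p.2), (p.1, finNext p.2)]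

/-- The colours of the edges from `p` to its left, right, lower and upper neighbour. -/
def nbrColor (K : TorusColoring) (p : Fin m × Fin n) : Fin 4 → Fin 3 :=
  ![K.hor (finPrev p.1) p.2, K.hor p.1 p.2, K.ver p.1 (finPrev p.2), K.ver p.1 p.2]

lemma nbr_injective (hm : 3 ≤ m) (hn : 3 ≤ n) (p : Fin m × Fin n) :
    Function.Injective (nbr p) := by
  have h₁ := finNext_ne hm p.1
  have h₂ := finPrev_ne hm p.1
  have h₃ := finNext_ne_finPrev hm p.1
  have h₄ := finNext_ne hn p.2
  have h₅ := finPrev_ne hn p.2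
  have h₆ := finNext_ne_finPrev hn p.2
  intro a b
  fin_cases a <;> fin_cases b <;>
    simp [nbr, h₁, h₂, h₃, h₄, h₅, h₆, h₁.symm, h₂.symm, h₃.symm, h₄.symm, h₅.symm, h₆.symm]

/-- The opposite of one of the directions left, right, down and up. -/
def opp : Fin 4 → Fin 4 := ![1, 0, 3, 2]

lemma nbr_nbr_opp (p : Fin m × Fin n) (d : Fin 4) : nbr (nbr p d) (opp d) = p := by
  fin_cases d <;> simp [nbr, opp, finNext_finPrev, finPrev_finNext]

lemma nbrColor_nbr_opp (p : Fin m × Fin n) (d : Fin 4) :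
    K.nbrColor (nbr p d) (opp d) = K.nbrColor p d := by
  fin_cases d <;> simp [nbr, nbrColor, opp, finPrev_finNext]

lemma boxProd_adj_iff (hm : 3 ≤ m) (hn : 3 ≤ n) :
    ((cycleGraph m).boxProd (cycleGraph n)).Adj p q ↔ ∃ d, q = nbr p d := by
  obtain ⟨a, b⟩ := p
  obtain ⟨a', b'⟩ := q
  rw [boxProd_adj, cycleGraph_adj_iff hm, cycleGraph_adj_iff hn]
  simp only [Fin.exists_fin_succ, nbr, eq_finNext_iff (i := a), eq_finNext_iff (i := b)]
  simp [Prod.ext_iff]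
  grind

/-- The subgraph of all edges of colour `c` and their endpoints. -/
def colorClass (K : TorusColoring) (hm : 3 ≤ m) (hn : 3 ≤ n) (c : Fin 3) :
    ((cycleGraph m).boxProd (cycleGraph n)).Subgraph where
  verts := {p | ∃ d, K.nbrColor p d = c}
  Adj p q := ∃ d, q = nbr p d ∧ K.nbrColor p d = c
  adj_sub := fun ⟨d, hd, _⟩ => (boxProd_adj_iff hm hn).2 ⟨d, hd⟩
  edge_vert := fun ⟨d, _, hd⟩ => ⟨d, hd⟩
  symm := ⟨fun p _ ⟨d, hq, hd⟩ =>
    ⟨opp d, by rw [hq, nbr_nbr_opp], by rw [hq, nbrColor_nbr_opp, hd]⟩⟩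

variable {hm : 3 ≤ m} {hn : 3 ≤ n}

lemma colorClass_adj : (K.colorClass hm hn c).Adj p q ↔ ∃ d, q = nbr p d ∧ K.nbrColor p d = c :=
  Iff.rfl

lemma colorClass_adj_unique (h : (K.colorClass hm hn c).Adj p q)
    (h' : (K.colorClass hm hn c').Adj p q) : c = c' := by
  obtain ⟨d, hd, rfl⟩ := h
  obtain ⟨d', hd', rfl⟩ := h'
  rw [nbr_injective hm hn p (hd.symm.trans hd')]

lemma pairwise_disjoint_colorClass :
    Pairwise fun c c' => Disjoint (K.colorClass hm hn c).edgeSet (K.colorClass hm hn c').edgeSet := by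
  intro c c' hc
  rw [Set.disjoint_left]
  intro e he he'
  induction e with
  | _ p q => exact hc (colorClass_adj_unique (Subgraph.mem_edgeSet.1 he) (Subgraph.mem_edgeSet.1 he'))

lemma iUnion_colorClass :
    ⋃ c, (K.colorClass hm hn c).edgeSet = ((cycleGraph m).boxProd (cycleGraph n)).edgeSet := by
  refine (Set.iUnion_subset fun c => Subgraph.edgeSet_subset _).antisymm fun e he => ?_
  induction e with
  | _ p q =>
    obtain ⟨d, hd⟩ := (boxProd_adj_iff hm hn).1 he
    exact Set.mem_iUnion.2 ⟨K.nbrColor p d, Subgraph.mem_edgeSet.2 ⟨d, hd, rfl⟩⟩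

/-- The number of edges of colour `c` at `p`. -/
def colorDegree (K : TorusColoring) (c : Fin 3) (p : Fin m × Fin n) : ℕ :=
  ∑ d, if K.nbrColor p d = c then 1 else 0

lemma ncard_neighborSet_colorClass :
    ((K.colorClass hm hn c).neighborSet p).ncard = K.colorDegree c p := by
  have : (K.colorClass hm hn c).neighborSet p =
      nbr p '' (univ.filter fun d => K.nbrColor p d = c : Finset (Fin 4)) := by
    ext q
    simp only [Subgraph.mem_neighborSet, colorClass_adj, coe_filter, mem_univ, true_and,
      Set.mem_image, Set.mem_ofPred_eq]
    exact ⟨fun ⟨d, h₁, h₂⟩ => ⟨d, h₂, h₁.symm⟩, fun ⟨d, h₁, h₂⟩ => ⟨d, h₂.symm, h₁⟩⟩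
  rw [this, Set.ncard_image_of_injective _ (nbr_injective hm hn p), Set.ncard_coe_finset,
    card_filter, colorDegree]

lemma colorDegree_eq (hK : K.Local m n) (c : Fin 3) (p : Fin m × Fin n) :
    K.colorDegree c p = if ∃ d, K.nbrColor p d = c then 2 else 0 := by
  have h : PairedUp (K.nbrColor p 0) (K.nbrColor p 1) (K.nbrColor p 2) (K.nbrColor p 3) :=
    hK p.1 p.1.2 p.2 p.2.2
  have key : ∀ l r d u c : Fin 3, PairedUp l r d u →
      ((if l = c then 1 else 0) + (if r = c then 1 else 0) + (if d = c then 1 else 0) +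
        (if u = c then 1 else 0) : ℕ) = if l = c ∨ r = c ∨ d = c ∨ u = c then 2 else 0 := by
    decide
  rw [colorDegree, Fin.sum_univ_four, key _ _ _ _ _ h]
  simp [Fin.exists_fin_succ]

lemma sum_fin_prod (f : ℕ → ℕ → ℕ) :
    ∑ p : Fin m × Fin n, f p.1 p.2 = ∑ j ∈ range n, ∑ i ∈ range m, f i j := by
  rw [Fintype.sum_prod_type_right, ← Fin.sum_univ_eq_sum_range]
  exact Finset.sum_congr rfl fun j _ => Fin.sum_univ_eq_sum_range (fun i => f i j) m

/-- The handshaking lemma for a colour class. -/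
lemma sum_colorDegree : ∑ p : Fin m × Fin n, K.colorDegree c p = 2 * K.edgeCount m n c := by
  set h : ℕ → ℕ → ℕ := fun i j => if K.hor i j = c then 1 else 0
  set v : ℕ → ℕ → ℕ := fun i j => if K.ver i j = c then 1 else 0
  have : ∀ p : Fin m × Fin n, K.colorDegree c p =
      h (cycPred m p.1) p.2 + h p.1 p.2 + v p.1 (cycPred n p.2) + v p.1 p.2 := fun p => by
    rw [colorDegree, Fin.sum_univ_four]; rfl
  simp only [this]
  rw [sum_fin_prod fun i j => h (cycPred m i) j + h i j + v i (cycPred n j) + v i j]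
  simp only [sum_add_distrib]
  rw [sum_range_cycPred (fun j => ∑ i ∈ range m, v i j)]
  simp only [fun j => sum_range_cycPred (n := m) (fun i => h i j)]
  simp only [edgeCount, sum_add_distrib]
  ring

lemma ncard_verts_colorClass (hK : K.Local m n) :
    (K.colorClass hm hn c).verts.ncard = K.edgeCount m n c := by
  classical
  have h := sum_colorDegree (K := K) (m := m) (n := n) (c := c)
  simp only [colorDegree_eq hK, ← sum_filter, sum_const, smul_eq_mul] at h
  have : (K.colorClass hm hn c).verts =
      (univ.filter fun p : Fin m × Fin n => ∃ d, K.nbrColor p d = c : Finset _) := by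
    ext p; simp [colorClass]
  rw [this, Set.ncard_coe_finset]
  omega

/-- The coordinates of a vertex as natural numbers. -/
def natPair (p : Fin m × Fin n) : ℕ × ℕ := (p.1, p.2)

lemma natPair_injective : Function.Injective (natPair : Fin m × Fin n → ℕ × ℕ) :=
  fun _ _ h => Prod.ext (Fin.ext (congrArg Prod.fst h)) (Fin.ext (congrArg Prod.snd h))

/-- The alternative `a = b` accounts for points outside the torus, which are linked to themselves
only. -/
lemma reachable_of_linked {a b : ℕ × ℕ} (h : K.Linked m n n c a b) :
    a = b ∨ ∃ p q : (K.colorClass hm hn c).verts, natPair p.1 = a ∧ natPair q.1 = b ∧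
      (K.colorClass hm hn c).coe.Reachable p q := by
  induction h with
  | rel x y hxy =>
    right
    have aux : ∀ (p : Fin m × Fin n) (d : Fin 4), K.nbrColor p d = c →
        ∃ p' q' : (K.colorClass hm hn c).verts, natPair p'.1 = natPair p ∧
          natPair q'.1 = natPair (nbr p d) ∧ (K.colorClass hm hn c).coe.Reachable p' q' :=
      fun p d hd =>
        have hadj : (K.colorClass hm hn c).Adj p (nbr p d) := ⟨d, rfl, hd⟩
        ⟨⟨p, hadj.fst_mem⟩, ⟨nbr p d, hadj.snd_mem⟩, rfl, rfl, hadj.coe.reachable⟩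
    cases hxy with
    | @right i j hi hj hc => exact aux (⟨i, hi⟩, ⟨j, hj⟩) 1 hc
    | @up i j hi hj hc => exact aux (⟨i, hi⟩, ⟨j, hj⟩) 3 hc
  | refl x => exact .inl rfl
  | symm x y _ ih =>
    rcases ih with rfl | ⟨p, q, hp, hq, hpq⟩
    · exact .inl rfl
    · exact .inr ⟨q, p, hq, hp, hpq.symm⟩
  | trans x y z _ _ ih₁ ih₂ =>
    rcases ih₁ with rfl | ⟨p, q, hp, hq, hpq⟩
    · exact ih₂
    rcases ih₂ with rfl | ⟨p', q', hp', hq', hpq'⟩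
    · exact .inr ⟨p, q, hp, hq, hpq⟩
    have : q = p' := Subtype.ext (natPair_injective (hq.trans hp'.symm))
    subst this
    exact .inr ⟨p, q', hp, hq', hpq.trans hpq'⟩

lemma exists_tail (p : (K.colorClass hm hn c).verts) :
    ∃ q : (K.colorClass hm hn c).verts, (K.hor q.1.1 q.1.2 = c ∨ K.ver q.1.1 q.1.2 = c) ∧
      (K.colorClass hm hn c).coe.Reachable p q := by
  obtain ⟨p, d, hd⟩ := p
  have hadj : (K.colorClass hm hn c).Adj p (nbr p d) := ⟨d, rfl, hd⟩
  fin_cases d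
  · exact ⟨⟨_, hadj.snd_mem⟩, .inl hd, hadj.coe.reachable⟩
  · exact ⟨⟨p, hadj.fst_mem⟩, .inl hd, .refl _⟩
  · exact ⟨⟨_, hadj.snd_mem⟩, .inr hd, hadj.coe.reachable⟩
  · exact ⟨⟨p, hadj.fst_mem⟩, .inr hd, .refl _⟩

lemma preconnected_colorClass (hK : K.IsCyclic m n) :
    (K.colorClass hm hn c).coe.Preconnected := by
  intro p q
  obtain ⟨p', hp', hpp'⟩ := exists_tail p
  obtain ⟨q', hq', hqq'⟩ := exists_tail q
  refine hpp'.trans (.trans ?_ hqq'.symm)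
  rcases reachable_of_linked (hm := hm) (hn := hn)
    (hK.conn c _ p'.1.1.2 _ p'.1.2.2 _ q'.1.1.2 _ q'.1.2.2 hp' hq') with h | ⟨a, b, ha, hb, hab⟩
  · rw [Subtype.ext (natPair_injective h : p'.1 = q'.1)]
  · rwa [Subtype.ext (natPair_injective ha : a.1 = p'.1),
      Subtype.ext (natPair_injective hb : b.1 = q'.1)] at hab

lemma nonempty_verts_colorClass (hK : K.IsCyclic m n)
    (hcount : 3 * K.edgeCount m n c = 2 * m * n) : (K.colorClass hm hn c).verts.Nonempty := by
  refine Set.nonempty_of_ncard_ne_zero ?_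
  have hpos : 0 < 2 * m * n := by positivity
  rw [ncard_verts_colorClass hK.loc]
  omega

lemma colorClass_injective (hK : K.IsCyclic m n)
    (hcount : ∀ c, 3 * K.edgeCount m n c = 2 * m * n) :
    Function.Injective (K.colorClass hm hn) := fun c c' h => by
  obtain ⟨p, d, hd⟩ := nonempty_verts_colorClass (hm := hm) (hn := hn) hK (hcount c)
  have hadj : (K.colorClass hm hn c).Adj p (nbr p d) := ⟨d, rfl, hd⟩
  exact colorClass_adj_unique hadj (h ▸ hadj)

lemma isCycleOfLength_colorClass (hK : K.IsCyclic m n)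
    (hcount : 3 * K.edgeCount m n c = 2 * m * n) :
    IsCycleOfLength (K.colorClass hm hn c) (2 * m * n / 3) := by
  classical
  have hcard : (K.colorClass hm hn c).verts.ncard = 2 * m * n / 3 := by
    rw [ncard_verts_colorClass hK.loc]; omega
  have := (nonempty_verts_colorClass (hm := hm) (hn := hn) hK hcount).to_subtype
  have hdeg : ∀ p : (K.colorClass hm hn c).verts,
      ((K.colorClass hm hn c).coe.neighborSet p).ncard = 2 := fun p => by
    rw [← Nat.card_coe_set_eq, Nat.card_congr (Subgraph.coeNeighborSetEquiv p),
      Nat.card_coe_set_eq, ncard_neighborSet_colorClass, colorDegree_eq hK.loc]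
    exact if_pos (show ∃ d, K.nbrColor p.1 d = c from p.2)
  have := nonempty_iso_cycleGraph ⟨preconnected_colorClass hK⟩ hdeg
  rwa [← Nat.card_eq_fintype_card, Nat.card_coe_set_eq, hcard] at this

end TorusColoring

theorem theorem1 (m n : ℕ) (hm : 3 ≤ m) (hn : 0 < n) (hn3 : 3 ∣ n) :
    ∃ D : Set (SimpleGraph.boxProd (SimpleGraph.cycleGraph m)
        (SimpleGraph.cycleGraph n)).Subgraph,
      IsDecomposition (SimpleGraph.boxProd (SimpleGraph.cycleGraph m)
        (SimpleGraph.cycleGraph n)) D ∧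
      D.ncard = 3 ∧
      ∀ H ∈ D, IsCycleOfLength H (2 * m * n / 3) := by
  have hn' : 3 ≤ n := Nat.le_of_dvd hn hn3
  obtain ⟨K, hK, hcount⟩ := TorusColoring.exists_isCyclic hm hn hn3
  have hcyc := fun c => TorusColoring.isCycleOfLength_colorClass (hm := hm) (hn := hn') hK (hcount c)
  have hdisj := TorusColoring.pairwise_disjoint_colorClass (K := K) (hm := hm) (hn := hn')
  have hinj := TorusColoring.colorClass_injective (hm := hm) (hn := hn') hK hcount
  refine ⟨Set.range (K.colorClass hm hn'), ⟨?_, ?_⟩, ?_, ?_⟩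
  · rintro _ ⟨c, rfl⟩ _ ⟨c', rfl⟩ hne
    exact hdisj fun h => hne (h ▸ rfl)
  · rw [Set.biUnion_range, TorusColoring.iUnion_colorClass]
  · rw [← Set.image_univ, Set.ncard_image_of_injective _ hinj, Set.ncard_univ, Nat.card_fin]
  · rintro _ ⟨c, rfl⟩
    exact hcyc c
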